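/- Let $\mathbb{G}=V_1\oplus\cdots\oplus V_\iota$ be a stratified group: a finite-dimensional real graded Lie algebra with $V_\iota\neq\{0\}$, $V_i=\{0\}$ for $i>\iota$ and $[V_1,V_j]=V_{j+1}$ for all $j\ge1$, equipped with the group law given by the Baker–Campbell–Hausdorff product (so the unit is $0$ and $x^{-1}=-x$), and with the dilations $\delta_r(x_1+\cdots+x_\iota)=r x_1+r^2x_2+\cdots+r^\iota x_\iota$ for $x_i\in V_i$. Let $n=\dim\mathbb{G}$, fix a graded basis of $\mathbb{G}$ (that is, a basis made of consecutive bases of $V_1,\dots,V_\iota$) and the scalar product that makes it orthonormal, and let $\mathcal{H}^{n-1}$ be the corresponding Euclidean $(n-1)$-dimensional Hausdorff measure. Let $d$ be a homogeneous distance on $\mathbb{G}$: a continuous, left invariant distance with $d(\delta_rx,\delta_ry)=r\,d(x,y)$ for all $x,y\in\mathbb{G}$ and $r>0$. Write $\mathbb{B}(z,r)=\{w\in\mathbb{G}: d(w,z)\le r\}$. For $v\in V_1\setminus\{0\}$ let $v^\perp$ be the orthogonal complement of $v$ in $V_1$, let $N(v)=v^\perp\oplus V_2\oplus\cdots\oplus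 V_\iota$, and set $$\beta(d,v)=\max_{z\in\mathbb{B}(0,1)}\mathcal{H}^{n-1}\big(\mathbb{B}(z,1)\cap N(v)\big).$$ If the unit ball $\mathbb{B}(0,1)$ is a convex subset of the vector space $\mathbb{G}$, then for every $v\in V_1\setminus\{0\}$ the maximum defining $\beta(d,v)$ is attained and finite, and $$\beta(d,v)=\mathcal{H}^{n-1}\big(N(v)\cap\mathbb{B}(0,1)\big).$$ -/

import Mathlib

open scoped ENNReal MeasureTheory

noncomputable section

namespace StratifiedGroup

section GroupLaw

variable {G : Type*} [LieRing G] [LieAlgebra ℝ G]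

/-- The right-nested bracket `⁅a₁, ⁅a₂, …, ⁅aₘ₋₁, aₘ⁆ …⁆⁆` of a word `a₁ a₂ … aₘ`. -/
def nestedBracket : List G → G
  | [] => 0
  | [a] => a
  | a :: b :: l => ⁅a, nestedBracket (b :: l)⁆

/-- The word `x^{r₁} y^{s₁} ⋯ x^{rₖ} y^{sₖ}`, where `p i = (rᵢ, sᵢ)`. -/
def word (x y : G) {k : ℕ} (p : Fin k → ℕ × ℕ) : List G :=
  (List.ofFn p).flatMap fun q => List.replicate q.1 x ++ List.replicate q.2 y

/-- The exponents `(rᵢ, sᵢ)`, `i = 1, …, k`, with `rᵢ + sᵢ ≥ 1` and `∑ᵢ (rᵢ + sᵢ) = m`. -/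
def dynkinIndex (m k : ℕ) : Finset (Fin k → ℕ × ℕ) :=
  {p ∈ Fintype.piFinset fun _ => Finset.range (m + 1) ×ˢ Finset.range (m + 1) |
    (∀ i, 1 ≤ (p i).1 + (p i).2) ∧ ∑ i, ((p i).1 + (p i).2) = m}

/-- The part of degree `m` of the Baker–Campbell–Hausdorff series `log (exp x exp y)`, in Dynkin's
form. -/
def bchTerm (m : ℕ) (x y : G) : G :=
  ∑ k ∈ Finset.Icc 1 m, ∑ p ∈ dynkinIndex m k,
    ((-1 : ℝ) ^ (k - 1) / k * (1 / m) *
      (∏ i, (((p i).1.factorial : ℝ) * ((p i).2.factorial : ℝ)))⁻¹) • nestedBracket (word x y p)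

/-- The group law of the simply connected nilpotent Lie group of Lie algebra `G`, read on `G` through
the exponential map: the Baker–Campbell–Hausdorff product. In a Lie algebra that is nilpotent of step
at most `step`, the terms of degree larger than `step` vanish, so that the series is the finite sum
below. The unit is `0` and the inverse of `x` is `-x`. -/
def mul (step : ℕ) (x y : G) : G :=
  ∑ m ∈ Finset.Icc 1 step, bchTerm m x y

/-- A graded Lie algebra `G = V₁ ⊕ ⋯ ⊕ V_step` is stratified: `V_step ≠ 0`, `Vᵢ = 0` for `i > step`,
and `[V₁, Vⱼ] = Vⱼ₊₁` for all `j ≥ 1`. The grading is indexed by `ℕ`, with `V₀ = 0`; that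
`G = ⨁ Vᵢ` and `[Vᵢ, Vⱼ] ⊆ Vᵢ₊ⱼ` is Mathlib's `GradedLieAlgebra V`. -/
structure IsStratified (V : ℕ → Submodule ℝ G) (step : ℕ) : Prop where
  layer_zero : V 0 = ⊥
  layer_step_ne : V step ≠ ⊥
  layer_eq_bot : ∀ i, step < i → V i = ⊥
  span_bracket : ∀ j, 1 ≤ j →
    Submodule.span ℝ {z : G | ∃ x ∈ V 1, ∃ y ∈ V j, ⁅x, y⁆ = z} = V (j + 1)

variable (V : ℕ → Submodule ℝ G) [GradedLieAlgebra V]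

/-- The dilation `δ_r (x₁ + ⋯ + x_step) = r x₁ + r² x₂ + ⋯ + r^step x_step`, with `xᵢ ∈ Vᵢ`. -/
def dilation (step : ℕ) (r : ℝ) (x : G) : G :=
  ∑ i ∈ Finset.Icc 1 step, r ^ i • (DirectSum.decompose V x i : G)

/-- A homogeneous distance: a continuous left invariant distance with
`d (δ_r x) (δ_r y) = r d(x, y)`. -/
structure IsHomogeneousDistance [TopologicalSpace G] (step : ℕ) (d : G → G → ℝ) : Prop where
  eq_zero_iff : ∀ x y, d x y = 0 ↔ x = y
  symm : ∀ x y, d x y = d y x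
  triangle : ∀ x y z, d x z ≤ d x y + d y z
  continuous : Continuous fun p : G × G => d p.1 p.2
  left_invariant : ∀ z x y, d (mul step z x) (mul step z y) = d x y
  homogeneous : ∀ r : ℝ, 0 < r → ∀ x y, d (dilation V step r x) (dilation V step r y) = r * d x y

end GroupLaw

/-- The closed ball of centre `z` and radius `r` of `d`. -/
def closedBall {G : Type*} (d : G → G → ℝ) (z : G) (r : ℝ) : Set G :=
  {w | d w z ≤ r}

section Euclidean

variable {G : Type*} [AddCommGroup G] [Module ℝ G] {n : ℕ}

/-- `m_j = dim V₁ + ⋯ + dim V_j`. -/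
def layerDim (V : ℕ → Submodule ℝ G) (j : ℕ) : ℕ :=
  ∑ i ∈ Finset.Icc 1 j, Module.finrank ℝ (V i)

/-- A graded basis: for each `j ≥ 1`, its elements number `m_{j-1} + 1, …, m_j` are a basis of `V_j`
(they are numbered from `0` here; as part of a basis they are linearly independent). -/
def IsGradedBasis (V : ℕ → Submodule ℝ G) (e : Module.Basis (Fin n) ℝ G) : Prop :=
  ∀ j, 1 ≤ j →
    Submodule.span ℝ (e '' {i : Fin n | layerDim V (j - 1) ≤ i ∧ (i : ℕ) < layerDim V j}) = V j

/-- The coordinates with respect to the basis `e`, as a map onto Euclidean space. The scalar product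
of `G` is the one that makes `e` orthonormal, which is to say that this map is an isometry. -/
def coord (e : Module.Basis (Fin n) ℝ G) : G ≃ₗ[ℝ] EuclideanSpace ℝ (Fin n) :=
  e.equivFun.trans (WithLp.linearEquiv 2 ℝ (Fin n → ℝ)).symm

/-- The `(n-1)`-dimensional Hausdorff measure of a subset of the `n`-dimensional space `G`, for the
scalar product that makes `e` orthonormal (normalized so that it is Lebesgue measure on
`(n-1)`-dimensional subspaces). -/
def area (e : Module.Basis (Fin n) ℝ G) (A : Set G) : ℝ≥0∞ :=
  μHE[n - 1] (coord e '' A)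

/-- The vertical subgroup `N(ν) = ν^⊥ ⊕ V₂ ⊕ ⋯`, where `ν^⊥` is the orthogonal complement of `ν`
within `V₁`. -/
def verticalSubgroup (V : ℕ → Submodule ℝ G) (e : Module.Basis (Fin n) ℝ G) (ν : G) :
    Submodule ℝ G :=
  (V 1 ⊓ (Submodule.span ℝ {coord e ν})ᗮ.comap (coord e).toLinearMap) ⊔ ⨆ j ≥ 2, V j

/-- `β(d, ν)`: the largest area of the slice by `N(ν)` of a closed unit ball `B(z, 1)` with
`z ∈ B(0, 1)`. It is written as a supremum in `[0, ∞]`. -/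
def beta (V : ℕ → Submodule ℝ G) (e : Module.Basis (Fin n) ℝ G) (d : G → G → ℝ) (ν : G) : ℝ≥0∞ :=
  ⨆ z ∈ closedBall d 0 1, area e (closedBall d z 1 ∩ verticalSubgroup V e ν)

end Euclidean

end StratifiedGroup

end

/-! By left invariance, `B(z, 1)` is the left translate of `B(0, 1)` by `z`. Choose `w ∈ ℝv` with `z
+ w ∈ N(v)`. The product of `z` and `y + w` is `z + w + y` plus brackets, and brackets lie in `V₂ ⊕
V₃ ⊕ ⋯ ⊆ N(v)`, so left translation by `z` carries the affine hyperplane `w + N(v)` into `N(v)`.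
Read on `N(v)`, this map is the identity plus a term whose increments lie deeper in the filtration
by degree; it is a composite of shears, hence preserves area
(`measurePreserving_add_of_filtration`). The slice of `B(z, 1)` by `N(v)` thus has the area of the
slice of `B(0, 1)` by the parallel hyperplane `w + N(v)` (`volume_preimage_closedBall_le`).

The ball is convex, and symmetric because `-x` is the group inverse. If `A` is a parallel slice,
then `(A - A) / 2` lies in the central one, and Brunn–Minkowski gives that the central slice is the
largest (`volume_preimage_add_le`). It is the slice for `z = 0`, so the maximum is attained;
compactness of the ball makes it finite.

Associativity of the product plays no role: only its degree-one part `x + y`, its values on a line,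
and the effect of brackets on degrees matter. -/

noncomputable section

namespace StratifiedGroup

/-! ### Brunn–Minkowski for a set and its opposite. -/

section BrunnMinkowski

open MeasureTheory Set

/-- A function with larger superlevel sets has a larger integral. -/
theorem lintegral_le_of_measure_lt_le {α : Type*} [MeasurableSpace α] {μ : Measure α} [SFinite μ]
    {f h : α → ℝ≥0∞} (hf : Measurable f) (hh : Measurable h)
    (hfh : ∀ t, μ {a | t < f a} ≤ μ {a | t < h a}) :
    ∫⁻ a, f a ∂μ ≤ ∫⁻ a, h a ∂μ := by
  -- Layer-cake formula: Tonelli on the strict subgraph of `g`.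
  have key : ∀ g : α → ℝ≥0∞, Measurable g →
      ∫⁻ a, g a ∂μ = ∫⁻ t : ℝ, μ {a | 0 ≤ t ∧ ENNReal.ofReal t < g a} := by
    intro g hg
    have hS : MeasurableSet {p : α × ℝ | 0 ≤ p.2 ∧ ENNReal.ofReal p.2 < g p.1} :=
      (measurableSet_le measurable_const measurable_snd).inter
        (measurableSet_lt (ENNReal.measurable_ofReal.comp measurable_snd) (hg.comp measurable_fst))
    have e1 := Measure.prod_apply (μ := μ) (ν := (volume : Measure ℝ)) hS
    rw [Measure.prod_apply_symm hS] at e1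
    refine Eq.trans ?_ e1.symm
    refine lintegral_congr fun a => ?_
    simp only [preimage_ofPred_eq]
    rcases eq_or_ne (g a) ⊤ with h | h
    · rw [h]
      simp only [ENNReal.ofReal_lt_top, and_true]
      exact (Real.volume_Ici (a := 0)).symm
    · have : {t : ℝ | 0 ≤ t ∧ ENNReal.ofReal t < g a} = Ico 0 (g a).toReal := by
        ext t
        simp only [mem_ofPred_eq, mem_Ico]
        exact and_congr_right fun ht => ENNReal.ofReal_lt_iff_lt_toReal ht h
      rw [this, Real.volume_Ico, sub_zero, ENNReal.ofReal_toReal h]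
  rw [key f hf, key h hh]
  refine lintegral_mono fun t => ?_
  by_cases ht : 0 ≤ t
  · simpa [ht] using hfh (ENNReal.ofReal t)
  · simp [ht]

/-- For compact `K ⊆ A`, `L ⊆ B` with maxima `a`, `l`, the set `K - L` contains `K - l`, to the left
of `a - l`, and `a - L`, to its right. These meet only at `a - l`, so `|K| + |L| ≤ |2D| = 2|D|`. Two
distinct sets are needed because the induction on dimension compares different fibres. -/
theorem lt_volume_of_half_sub_mem_real {A B D : Set ℝ} (hA : MeasurableSet A)
    (hB : MeasurableSet B) (h : ∀ x ∈ A, ∀ y ∈ B, (2 : ℝ)⁻¹ * (x - y) ∈ D) {t : ℝ≥0∞}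
    (htA : t < volume A) (htB : t < volume B) : t < volume D := by
  obtain ⟨K, hKA, hK, htK⟩ := hA.exists_lt_isCompact htA
  obtain ⟨L, hLB, hL, htL⟩ := hB.exists_lt_isCompact htB
  obtain ⟨a, haK, ha⟩ := hK.exists_isGreatest (nonempty_of_measure_ne_zero (ne_bot_of_gt htK))
  obtain ⟨l, hlL, hl⟩ := hL.exists_isGreatest (nonempty_of_measure_ne_zero (ne_bot_of_gt htL))
  set E : Set ℝ := (fun x => (2 : ℝ)⁻¹ * x) ⁻¹' D with hE
  have hED : volume E = 2 * volume D := by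
    rw [hE, Real.volume_preimage_mul_left (by norm_num)]
    norm_num
  have h1 : volume K ≤ volume (E ∩ Iic (a - l)) := by
    rw [← measure_preimage_add_right volume l K]
    refine measure_mono fun x hx => ⟨?_, ?_⟩
    · have := h _ (hKA hx) _ (hLB hlL)
      simpa [hE] using this
    · have := ha hx
      simp only [mem_Iic]
      linarith
  have h2 : volume L ≤ volume (E \ Iic (a - l)) := by
    have hinv : volume ((fun x => a - x) ⁻¹' L) = volume L :=
      (volume.measurePreserving_sub_left a).measure_preimage hL.measurableSet.nullMeasurableSet
    -- Dropping the null point `a - l` makes the two pieces disjoint.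
    rw [← hinv, ← measure_sdiff_null (s := (fun x => a - x) ⁻¹' L)
      (measure_singleton (μ := volume) (a - l))]
    refine measure_mono fun x hx => ⟨?_, ?_⟩
    · have := h _ (hKA haK) _ (hLB hx.1)
      simpa [hE] using this
    · have h3 := hl hx.1
      have h4 : x ≠ a - l := hx.2
      simp only [mem_Iic, not_le]
      exact lt_of_le_of_ne (by linarith) h4.symm
  have h3 : volume K + volume L ≤ 2 * volume D := by
    rw [← hED, ← measure_inter_add_sdiff E (measurableSet_Iic (a := a - l))]
    exact add_le_add h1 h2
  have h4 : 2 * t < 2 * volume D := by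
    rw [two_mul]
    exact (ENNReal.add_lt_add htK htL).trans_le h3
  exact lt_of_mul_lt_mul_left' h4

/-- The Brunn–Minkowski inequality for `A` and `-A`. -/
theorem volume_le_of_half_sub_mem {n : ℕ} {A D : Set (Fin n → ℝ)} (hA : MeasurableSet A)
    (hD : MeasurableSet D) (h : ∀ x ∈ A, ∀ y ∈ A, (2 : ℝ)⁻¹ • (x - y) ∈ D) :
    volume A ≤ volume D := by
  induction n with
  | zero =>
    refine measure_mono fun x hx => ?_
    rw [Subsingleton.elim x ((2 : ℝ)⁻¹ • (x - x))]
    exact h x hx x hx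
  | succ n ih =>
    set e := (MeasurableEquiv.piFinSuccAbove (fun _ : Fin (n + 1) => ℝ) 0).symm with he
    have hmp : MeasurePreserving e := (volume_preserving_piFinSuccAbove (fun _ => ℝ) 0).symm
    have hsub : ∀ p q : ℝ × (Fin n → ℝ), (2 : ℝ)⁻¹ • (e p - e q) = e ((2 : ℝ)⁻¹ • (p - q)) := by
      intro p q
      ext i
      refine Fin.cases ?_ (fun j => ?_) i <;> simp [he]
    have hA' := e.measurable hA
    have hD' := e.measurable hD
    rw [← hmp.measure_preimage hA.nullMeasurableSet, ← hmp.measure_preimage hD.nullMeasurableSet,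
      Measure.volume_eq_prod, Measure.prod_apply_symm hA', Measure.prod_apply_symm hD']
    have hfA := measurable_measure_prodMk_right (μ := (volume : Measure ℝ)) hA'
    have hfD := measurable_measure_prodMk_right (μ := (volume : Measure ℝ)) hD'
    -- The induction hypothesis applies to the sets of base points whose fibre is longer than `t`;
    -- its assumption is the one-dimensional case on two fibres.
    refine lintegral_le_of_measure_lt_le hfA hfD fun t => ?_
    refine ih (measurableSet_lt measurable_const hfA) (measurableSet_lt measurable_const hfD) ?_
    intro y hy z hz
    refine lt_volume_of_half_sub_mem_real (measurable_prodMk_right hA')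
      (measurable_prodMk_right hA') ?_ hy hz
    intro a ha b hb
    have := h _ ha _ hb
    rw [hsub] at this
    exact this

/-- Among the parallel slices of a symmetric convex set, the central one is the largest. -/
theorem volume_preimage_add_le {m : ℕ} {E : Type*} [AddCommGroup E] [Module ℝ E]
    {K : Set E} (hK : Convex ℝ K) (hsymm : ∀ x ∈ K, -x ∈ K)
    (L : EuclideanSpace ℝ (Fin m) →ₗ[ℝ] E) (w : E)
    (hA : MeasurableSet {x | L x + w ∈ K}) (hD : MeasurableSet {x | L x ∈ K}) :
    volume {x | L x + w ∈ K} ≤ volume {x | L x ∈ K} := by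
  have hmp := PiLp.volume_preserving_toLp (Fin m)
  rw [← hmp.measure_preimage hA.nullMeasurableSet, ← hmp.measure_preimage hD.nullMeasurableSet]
  refine volume_le_of_half_sub_mem (hmp.measurable hA) (hmp.measurable hD) ?_
  intro x hx y hy
  -- In the midpoint of `L x + w` and `-(L y + w)` the offset `w` cancels.
  have h1 := hK hx (hsymm _ hy) (show (0 : ℝ) ≤ 2⁻¹ by norm_num) (show (0 : ℝ) ≤ 2⁻¹ by norm_num)
    (by norm_num)
  simp only [mem_preimage, mem_ofPred_eq, WithLp.toLp_smul, WithLp.toLp_sub, map_smul, map_sub]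
  convert h1 using 1
  module

end BrunnMinkowski

/-! ### Volume-preserving unipotent maps. -/

section Shear

open MeasureTheory

variable {E : Type*} [NormedAddCommGroup E] [InnerProductSpace ℝ E] [FiniteDimensional ℝ E]
  [MeasurableSpace E] [BorelSpace E]

/-- A shear in the directions of a subspace `U` preserves the volume. -/
theorem measurePreserving_shear (U : Submodule ℝ E) {g : E → E} (hg : Measurable g)
    (hU : ∀ x, g x ∈ U) (hinv : ∀ x, ∀ u ∈ U, g (x + u) = g x) :
    MeasurePreserving (fun x => x + g x) volume volume := by
  have hψ := Uᗮ.measurePreserving_measurableEquivProd (0 : E)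
  rw [InnerProductSpace.euclideanHausdorffMeasure_eq_volume] at hψ
  set ψ := Uᗮ.measurableEquivProd (0 : E)
  set c : Uᗮ → Uᗮᗮ := fun w => Uᗮᗮ.orthogonalProjectionOnto (g w)
  have hc : Measurable c :=
    Uᗮᗮ.orthogonalProjectionOnto.continuous.measurable.comp (hg.comp measurable_subtype_coe)
  -- `g` depends only on the `Uᗮ` component, so each fibre along `Uᗮᗮ = U` is merely translated.
  have hskew : MeasurePreserving (fun p : Uᗮ × Uᗮᗮ => (p.1, p.2 + c p.1))
      ((volume : Measure Uᗮ).prod (volume : Measure Uᗮᗮ))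
      ((volume : Measure Uᗮ).prod (volume : Measure Uᗮᗮ)) :=
    (MeasurePreserving.id _).skew_product (g := fun a b => b + c a)
      (measurable_snd.add (hc.comp measurable_fst))
      (.of_forall fun a => map_add_right_eq_self _ _)
  have := (hψ.symm).comp (hskew.comp hψ)
  suffices h : (fun x => x + g x) = ψ.symm ∘ (fun p => (p.1, p.2 + c p.1)) ∘ ψ by
    rw [h]
    exact this
  funext x
  obtain ⟨p, rfl⟩ := ψ.symm.surjective x
  have e1 : ∀ q : Uᗮ × Uᗮᗮ, ψ.symm q = (q.1 : E) + q.2 := by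
    intro q
    simp [ψ]
  have e2 : g (ψ.symm p) = g p.1 := by
    rw [e1]
    exact hinv _ _ (by simpa only [Submodule.orthogonal_orthogonal] using p.2.2)
  have e3 : (c p.1 : E) = g p.1 := by
    refine Submodule.starProjection_eq_self_iff.2 ?_
    exact U.le_orthogonal_orthogonal (hU _)
  simp only [Function.comp_apply, MeasurableEquiv.apply_symm_apply]
  rw [e2, e1, e1]
  simp only [Submodule.coe_add, e3, add_assoc]

/-- A map that differs from the identity by a map `q` that raises the degree of a filtration
preserves the volume. -/
theorem measurePreserving_add_of_filtration (F : ℕ → Submodule ℝ E) (hF : Antitone F)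
    (hF1 : F 1 = ⊤) {s : ℕ} (hFs : F (s + 1) = ⊥) {q : E → E} (hq : Measurable q)
    (hqF : ∀ k, 1 ≤ k → ∀ x y, x - y ∈ F k → q x - q y ∈ F (k + 1)) :
    MeasurePreserving (fun x => x + q x) volume volume := by
  -- Descending induction on `k`, from the identity at `k = s + 1` to the full map at `k = 1`; each
  -- step composes with one shear along `F k`.
  have key : ∀ j k, k + j = s + 1 → 1 ≤ k →
      MeasurePreserving (fun x => x + (F k).starProjection (q x)) volume volume := by
    intro j
    induction j with
    | zero =>
      intro k hk _
      have : F k = ⊥ := by rw [← hFs, ← hk, add_zero]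
      simp only [this, Submodule.starProjection_bot, zero_apply, add_zero]
      exact MeasurePreserving.id _
    | succ j ih =>
      intro k hk hk1
      have hle : F (k + 1) ≤ F k := hF k.le_succ
      have hid : ∀ k', ∀ z ∈ F k', (F k').starProjection z = z := fun k' z hz =>
        Submodule.starProjection_eq_self_iff.2 hz
      set g : E → E := fun x => (F k).starProjection (q x) - (F (k + 1)).starProjection (q x)
      have hg : Measurable g :=
        ((F k).starProjection.continuous.measurable.comp hq).sub
          ((F (k + 1)).starProjection.continuous.measurable.comp hq)
      have hgU : ∀ x, g x ∈ F k := fun x =>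
        sub_mem (Submodule.starProjection_apply_mem _ _)
          (hle (Submodule.starProjection_apply_mem _ _))
      -- The increment of `q` along `u` lies in `F (k + 1)`, where both projections are the
      -- identity, so it cancels in `g`.
      have hginv : ∀ x, ∀ u ∈ F k, g (x + u) = g x := by
        intro x u hu
        have h1 := hqF k hk1 (x + u) x (by simpa using hu)
        have h2 := hid (k + 1) _ h1
        have h3 := hid k _ (hle h1)
        rw [map_sub] at h2 h3
        have h4 := h3.trans h2.symm
        rw [sub_eq_sub_iff_add_eq_add] at h4
        simp only [g]
        rw [sub_eq_sub_iff_add_eq_add, h4, add_comm]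
      have := (measurePreserving_shear (F k) hg hgU hginv).comp (ih (k + 1) (by omega) (by omega))
      suffices h : (fun x => x + (F k).starProjection (q x)) =
          (fun x => x + g x) ∘ (fun x => x + (F (k + 1)).starProjection (q x)) by
        rw [h]
        exact this
      funext x
      simp only [Function.comp_apply]
      rw [hginv x _ (hle (Submodule.starProjection_apply_mem _ _))]
      simp [g]
  have := key s 1 (by omega) le_rfl
  simpa only [hF1, Submodule.starProjection_top, ContinuousLinearMap.id_apply] using this

end Shear

/-! ### The filtration by degree. -/

section Tail

/-- The filtration `V_k ⊕ V_{k+1} ⊕ ⋯` of a graded space. -/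
def tail {G : Type*} [AddCommGroup G] [Module ℝ G] (V : ℕ → Submodule ℝ G) (k : ℕ) :
    Submodule ℝ G :=
  ⨆ j ≥ k, V j

theorem tail_antitone {G : Type*} [AddCommGroup G] [Module ℝ G] (V : ℕ → Submodule ℝ G) :
    Antitone (tail V) := fun _ _ h =>
  iSup₂_le fun j hj => le_iSup₂_of_le j (h.trans hj) le_rfl

theorem layer_sup_tail {G : Type*} [AddCommGroup G] [Module ℝ G] (V : ℕ → Submodule ℝ G) (k : ℕ) :
    V k ⊔ tail V (k + 1) = tail V k := by
  refine le_antisymm (sup_le (le_iSup₂_of_le k le_rfl le_rfl) (tail_antitone V k.le_succ))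
    (iSup₂_le fun j hj => ?_)
  rcases hj.eq_or_lt with rfl | h
  · exact le_sup_left
  · exact le_sup_of_le_right (le_iSup₂_of_le j h le_rfl)

variable {G : Type*} [LieRing G] [LieAlgebra ℝ G] {V : ℕ → Submodule ℝ G} {step : ℕ}

theorem IsStratified.tail_eq_bot (hV : IsStratified V step) : tail V (step + 1) = ⊥ :=
  le_bot_iff.1 (iSup₂_le fun j hj => (hV.layer_eq_bot j hj).le)

theorem IsStratified.one_le_step (hV : IsStratified V step) : 1 ≤ step :=
  Nat.one_le_iff_ne_zero.2 fun h => hV.layer_step_ne (h ▸ hV.layer_zero)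

variable [GradedLieAlgebra V]

theorem IsStratified.tail_one (hV : IsStratified V step) : tail V 1 = ⊤ := by
  have h := (DirectSum.Decomposition.isInternal V).submodule_iSup_eq_top
  refine top_le_iff.1 (h ▸ iSup_le fun j => ?_)
  rcases Nat.eq_zero_or_pos j with rfl | hj
  · rw [hV.layer_zero]
    exact bot_le
  · exact le_iSup₂_of_le j hj le_rfl

theorem disjoint_layer_tail (k : ℕ) : Disjoint (V k) (tail V (k + 1)) :=
  ((DirectSum.Decomposition.isInternal V).submodule_iSupIndep k).mono_right
    (iSup₂_le fun j hj => le_iSup₂_of_le j (by omega) le_rfl)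

theorem lie_mem_tail {a b : ℕ} {x y : G} (hx : x ∈ tail V a) (hy : y ∈ tail V b) :
    ⁅x, y⁆ ∈ tail V (a + b) := by
  have h1 : ∀ i, a ≤ i → ∀ u ∈ V i, ⁅u, y⁆ ∈ tail V (a + b) := by
    intro i hi u hu
    have : tail V b ≤ (tail V (a + b)).comap (LieAlgebra.ad ℝ G u) := by
      refine iSup₂_le fun j hj w hw => ?_
      exact (le_iSup₂_of_le (f := fun j (_ : j ≥ a + b) => V j) (i + j) (by omega) le_rfl :
        V (i + j) ≤ _) (SetLike.GradedBracket.bracket_mem hu hw)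
    exact this hy
  have h2 : tail V a ≤ (tail V (a + b)).comap (LieAlgebra.ad ℝ G y) := by
    refine iSup₂_le fun i hi u hu => ?_
    have := neg_mem (h1 i hi u hu)
    rw [lie_skew] at this
    exact this
  have := neg_mem (show ⁅y, x⁆ ∈ tail V (a + b) from h2 hx)
  rwa [lie_skew] at this

end Tail

/-! ### Degree estimates for the group law. -/

section BakerCampbellHausdorff

variable {G : Type*} [LieRing G] [LieAlgebra ℝ G]

-- Separating the pattern of letters from their values allows induction on a list of Booleans.
omit [LieRing G] [LieAlgebra ℝ G] in
theorem word_eq_map (x y : G) {k : ℕ} (p : Fin k → ℕ × ℕ) :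
    word x y p = ((List.ofFn p).flatMap fun q =>
      List.replicate q.1 true ++ List.replicate q.2 false).map fun b => cond b x y := by
  simp [word, List.map_flatMap]

theorem length_word_of_mem_dynkinIndex {m k : ℕ} {p : Fin k → ℕ × ℕ} (hp : p ∈ dynkinIndex m k) :
    ((List.ofFn p).flatMap fun q =>
      List.replicate q.1 true ++ List.replicate q.2 false).length = m := by
  simp only [dynkinIndex, Finset.mem_filter] at hp
  rw [← hp.2.2, List.length_flatMap]
  simp [List.sum_ofFn, Function.comp_def, List.map_ofFn]

theorem bchTerm_one (x y : G) : bchTerm 1 x y = x + y := by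
  have h : dynkinIndex 1 1 = {fun _ => (1, 0), fun _ => (0, 1)} := by decide
  have hne : (fun _ : Fin 1 => ((1 : ℕ), (0 : ℕ))) ≠ fun _ => (0, 1) := by decide
  simp [bchTerm, h, Finset.sum_pair hne, word, nestedBracket]

theorem mul_eq_add {step : ℕ} (h : 1 ≤ step) (x y : G) :
    mul step x y = x + y + ∑ m ∈ Finset.Icc 2 step, bchTerm m x y := by
  rw [mul, ← Finset.add_sum_Ioc_eq_sum_Icc h, bchTerm_one]
  rfl

theorem nestedBracket_map_smul (w : G) (c : Bool → ℝ) (l : List Bool) (hl : l ≠ []) :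
    (∃ r : ℝ, nestedBracket (l.map fun b => c b • w) = r • w) ∧
      (2 ≤ l.length → nestedBracket (l.map fun b => c b • w) = 0) := by
  induction l with
  | nil => exact absurd rfl hl
  | cons a l ih =>
    cases l with
    | nil => exact ⟨⟨c a, rfl⟩, by simp⟩
    | cons b l =>
      obtain ⟨⟨r, hr⟩, -⟩ := ih (by simp)
      have : nestedBracket ((a :: b :: l).map fun b => c b • w) = 0 := by
        change ⁅c a • w, nestedBracket ((b :: l).map fun b => c b • w)⁆ = 0
        rw [hr, smul_lie, lie_smul, lie_self, smul_zero, smul_zero]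
      exact ⟨⟨0, by rw [this, zero_smul]⟩, fun _ => this⟩

/-- The terms of degree at least two vanish on commuting elements of a line. -/
theorem bchTerm_smul_smul {m : ℕ} (hm : 2 ≤ m) (a b : ℝ) (w : G) :
    bchTerm m (a • w) (b • w) = 0 := by
  refine Finset.sum_eq_zero fun k _ => Finset.sum_eq_zero fun p hp => ?_
  have hlen := length_word_of_mem_dynkinIndex hp
  rw [word_eq_map]
  have hc : (fun t => cond t (a • w) (b • w)) = fun t : Bool => (cond t a b) • w := by
    funext t
    cases t <;> rfl
  rw [hc, (nestedBracket_map_smul w _ _ (by rintro h; simp [h] at hlen; omega)).2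
    (by rw [hlen]; exact hm), smul_zero]

theorem mul_smul_smul {step : ℕ} (h : 1 ≤ step) (a b : ℝ) (w : G) :
    mul step (a • w) (b • w) = (a + b) • w := by
  rw [mul_eq_add h, Finset.sum_eq_zero fun m hm => bchTerm_smul_smul (Finset.mem_Icc.1 hm).1 a b w,
    add_zero, add_smul]

variable {V : ℕ → Submodule ℝ G} [GradedLieAlgebra V] {step : ℕ}

/-- Bilinearity replaces one entry at a time, and bracketing with any element, of degree at least
one, gains a degree. -/
theorem nestedBracket_sub_mem_tail (hV : IsStratified V step) {k : ℕ} {f g : Bool → G}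
    (hfg : ∀ b, f b - g b ∈ tail V k) (l : List Bool) :
    nestedBracket (l.map f) - nestedBracket (l.map g) ∈ tail V k ∧
      (2 ≤ l.length → nestedBracket (l.map f) - nestedBracket (l.map g) ∈ tail V (k + 1)) := by
  have htop : ∀ x : G, x ∈ tail V 1 := fun x => by rw [hV.tail_one]; trivial
  induction l with
  | nil => exact ⟨by simp [nestedBracket], by simp⟩
  | cons a l ih =>
    cases l with
    | nil => exact ⟨hfg a, by simp⟩
    | cons b l =>
      have : nestedBracket ((a :: b :: l).map f) - nestedBracket ((a :: b :: l).map g) ∈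
          tail V (k + 1) := by
        change ⁅f a, nestedBracket ((b :: l).map f)⁆ - ⁅g a, nestedBracket ((b :: l).map g)⁆ ∈ _
        have h1 := lie_mem_tail (hfg a) (htop (nestedBracket ((b :: l).map f)))
        have h2 := lie_mem_tail (htop (g a)) ih.1
        rw [add_comm 1 k] at h2
        rw [sub_lie] at h1
        rw [lie_sub] at h2
        convert add_mem h1 h2 using 1
        abel
      exact ⟨tail_antitone V k.le_succ this, fun _ => this⟩

theorem bchTerm_sub_mem_tail (hV : IsStratified V step) {m k : ℕ} (hm : 2 ≤ m) (z : G) {y y' : G}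
    (h : y - y' ∈ tail V k) : bchTerm m z y - bchTerm m z y' ∈ tail V (k + 1) := by
  simp only [bchTerm, ← Finset.sum_sub_distrib, ← smul_sub]
  refine sum_mem fun i _ => sum_mem fun p hp => Submodule.smul_mem _ _ ?_
  rw [word_eq_map, word_eq_map]
  refine (nestedBracket_sub_mem_tail hV ?_ _).2 (by rw [length_word_of_mem_dynkinIndex hp]; exact hm)
  intro b
  cases b
  · exact h
  · simp

theorem continuous_lie [FiniteDimensional ℝ G] [TopologicalSpace G] [IsTopologicalAddGroup G]
    [ContinuousSMul ℝ G] [T2Space G] {X : Type*} [TopologicalSpace X] {f g : X → G}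
    (hf : Continuous f) (hg : Continuous g) : Continuous fun x => ⁅f x, g x⁆ := by
  let b := Module.finBasis ℝ G
  have h : ∀ x, ⁅f x, g x⁆ = ∑ i, b.repr (g x) i • ⁅f x, b i⁆ := by
    intro x
    conv_lhs => rw [← b.sum_repr (g x), ← LieAlgebra.ad_apply ℝ, map_sum]
    simp only [map_smul, LieAlgebra.ad_apply]
  simp only [h]
  refine continuous_finsetSum _ fun i _ => ?_
  have h1 : Continuous (b.coord i) := LinearMap.continuous_of_finiteDimensional _
  have h2 : Continuous (LieAlgebra.ad ℝ G (b i)) :=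
    LinearMap.continuous_of_finiteDimensional _
  refine (h1.comp hg).smul ?_
  have h3 : ∀ x, ⁅f x, b i⁆ = -⁅b i, f x⁆ := fun x => (lie_skew _ _).symm
  simp only [h3]
  exact (h2.comp hf).neg

theorem continuous_bchTerm [FiniteDimensional ℝ G] [TopologicalSpace G] [IsTopologicalAddGroup G]
    [ContinuousSMul ℝ G] [T2Space G] (m : ℕ) (z : G) : Continuous (bchTerm m z) := by
  refine continuous_finsetSum _ fun k _ => continuous_finsetSum _ fun p _ =>
    Continuous.const_smul ?_ _
  simp only [word_eq_map]
  generalize ((List.ofFn p).flatMap fun q =>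
    List.replicate q.1 true ++ List.replicate q.2 false) = l
  induction l with
  | nil => exact continuous_const
  | cons a l ih =>
    have ha : Continuous fun y => cond a z y := by
      cases a
      · exact continuous_id
      · exact continuous_const
    cases l with
    | nil => exact ha
    | cons b l => exact continuous_lie ha ih

end BakerCampbellHausdorff

/-! ### Dilations and compactness of the unit ball. -/

section Dilation

open Set

variable {G : Type*} [LieRing G] [LieAlgebra ℝ G] {V : ℕ → Submodule ℝ G} [GradedLieAlgebra V]
  {step : ℕ}

/-- The projection onto a layer, as a linear endomorphism. -/
def layerProj (V : ℕ → Submodule ℝ G) [GradedLieAlgebra V] (i : ℕ) : G →ₗ[ℝ] G :=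
  (V i).subtype ∘ₗ DirectSum.component ℝ ℕ (fun i => V i) i ∘ₗ
    (DirectSum.decomposeLinearEquiv V).toLinearMap

theorem dilation_eq (r : ℝ) (x : G) :
    dilation V step r x = ∑ i ∈ Finset.Icc 1 step, r ^ i • layerProj V i x := rfl

theorem IsStratified.layerProj_eq_zero (hV : IsStratified V step) {i : ℕ}
    (hi : i ∉ Finset.Icc 1 step) (x : G) : layerProj V i x = 0 := by
  have h : V i = ⊥ := by
    simp only [Finset.mem_Icc, not_and_or, not_le, Nat.lt_one_iff] at hi
    rcases hi with rfl | hi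
    · exact hV.layer_zero
    · exact hV.layer_eq_bot i hi
  exact (Submodule.mem_bot ℝ).1 (h.le (DirectSum.decompose V x i).2)

theorem IsStratified.dilation_one (hV : IsStratified V step) (x : G) :
    dilation V step 1 x = x := by
  classical
  conv_rhs => rw [← DirectSum.sum_support_decompose V x]
  simp only [dilation_eq, one_pow, one_smul]
  symm
  refine Finset.sum_subset (fun i hi => ?_) (fun i _ hi => ?_)
  · by_contra h
    exact (DFinsupp.mem_support_iff.1 hi) (Subtype.ext (hV.layerProj_eq_zero h x))
  · have := DFinsupp.notMem_support_iff.1 hi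
    exact congrArg Subtype.val this

theorem IsStratified.layerProj_dilation (hV : IsStratified V step) (r : ℝ) (x : G) (j : ℕ) :
    layerProj V j (dilation V step r x) = r ^ j • layerProj V j x := by
  have h : ∀ i, i ≠ j → layerProj V j (layerProj V i x) = 0 := fun i hij =>
    DirectSum.decompose_of_mem_ne V (DirectSum.decompose V x i).2 hij
  have h' : layerProj V j (layerProj V j x) = layerProj V j x :=
    DirectSum.decompose_of_mem_same V (DirectSum.decompose V x j).2
  simp only [dilation_eq, map_sum, map_smul]
  by_cases hj : j ∈ Finset.Icc 1 step
  · rw [Finset.sum_eq_single_of_mem j hj fun i _ hi => by rw [h i hi, smul_zero], h']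
  · rw [hV.layerProj_eq_zero hj, smul_zero]
    exact Finset.sum_eq_zero fun i _ => by rw [hV.layerProj_eq_zero hj, smul_zero]

theorem IsStratified.dilation_dilation (hV : IsStratified V step) (r s : ℝ) (x : G) :
    dilation V step r (dilation V step s x) = dilation V step (r * s) x := by
  rw [dilation_eq, dilation_eq (r * s)]
  refine Finset.sum_congr rfl fun i _ => ?_
  rw [hV.layerProj_dilation, smul_smul, mul_pow]

theorem dilation_zero_left (x : G) : dilation V step 0 x = 0 :=
  Finset.sum_eq_zero fun i hi => by
    rw [zero_pow (by have := (Finset.mem_Icc.1 hi).1; omega), zero_smul]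

theorem dilation_zero_right (r : ℝ) : dilation V step r (0 : G) = 0 := by
  simp [dilation_eq]

variable [TopologicalSpace G]

theorem IsHomogeneousDistance.dist_self {d : G → G → ℝ} (hd : IsHomogeneousDistance V step d)
    (x : G) : d x x = 0 := (hd.eq_zero_iff x x).2 rfl

theorem IsHomogeneousDistance.dist_pos {d : G → G → ℝ} (hd : IsHomogeneousDistance V step d)
    {x y : G} (hxy : x ≠ y) : 0 < d x y := by
  have h1 := hd.triangle x y x
  rw [hd.dist_self, hd.symm y x] at h1
  exact lt_of_le_of_ne (by linarith) fun h => hxy ((hd.eq_zero_iff x y).1 h.symm)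

theorem IsHomogeneousDistance.isClosed_closedBall {d : G → G → ℝ}
    (hd : IsHomogeneousDistance V step d) (z : G) (r : ℝ) : IsClosed (closedBall d z r) :=
  isClosed_le (hd.continuous.comp (continuous_id.prodMk continuous_const)) continuous_const

variable [IsTopologicalAddGroup G] [ContinuousSMul ℝ G] [T2Space G]

theorem continuous_dilation [FiniteDimensional ℝ G] :
    Continuous fun p : ℝ × G => dilation V step p.1 p.2 := by
  simp only [dilation_eq]
  refine continuous_finsetSum _ fun i _ => (continuous_fst.pow i).smul ?_
  exact (LinearMap.continuous_of_finiteDimensional (layerProj V i)).comp continuous_snd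

theorem IsHomogeneousDistance.isCompact_closedBall {d : G → G → ℝ} (hV : IsStratified V step)
    (hd : IsHomogeneousDistance V step d) {n : ℕ} (e : Module.Basis (Fin n) ℝ G) :
    IsCompact (closedBall d 0 1) := by
  have : FiniteDimensional ℝ G := e.finiteDimensional_of_finite
  have hc : Continuous (coord e) := (coord e).toLinearMap.continuous_of_finiteDimensional
  have hc' : Continuous (coord e).symm := (coord e).symm.toLinearMap.continuous_of_finiteDimensional
  have hcomp : ∀ K, IsCompact K → IsCompact (coord e ⁻¹' K) := by
    intro K hK
    have := hK.image hc'
    rwa [show (coord e).symm '' K = coord e ⁻¹' K from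
      (coord e).toEquiv.symm.image_eq_preimage_symm K] at this
  have hB := hcomp _ (ProperSpace.isCompact_closedBall (0 : EuclideanSpace ℝ (Fin n)) 1)
  have hS := hcomp _ (isCompact_sphere (0 : EuclideanSpace ℝ (Fin n)) 1)
  have hd0 : Continuous fun x => d x 0 :=
    hd.continuous.comp (continuous_id.prodMk continuous_const)
  obtain ⟨c, hc0, hcS⟩ := hS.exists_forall_le' (a := 0) hd0.continuousOn (by
    intro x hx
    refine hd.dist_pos ?_
    rintro rfl
    simp at hx)
  -- A point of the ball outside the Euclidean unit ball is `δ_{1/r}` of a point of the unit sphere.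
  -- There `d(·, 0) ≥ c`, so homogeneity forces `c ≤ r ≤ 1`.
  refine (hB.union ((isCompact_Icc (a := (1 : ℝ)) (b := c⁻¹)).prod hS |>.image
    (continuous_dilation (V := V) (step := step)))).of_isClosed_subset
      (hd.isClosed_closedBall 0 1) ?_
  intro x hx
  by_cases hx1 : ‖coord e x‖ ≤ 1
  · left
    simpa using hx1
  right
  have hcont : Continuous fun r : ℝ => ‖coord e (dilation V step r x)‖ :=
    (hc.comp (continuous_dilation.comp (continuous_id.prodMk continuous_const))).norm
  obtain ⟨r, ⟨hr0, hr1⟩, hr⟩ : (1 : ℝ) ∈ (fun r : ℝ => ‖coord e (dilation V step r x)‖) '' Icc 0 1 := by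
    refine intermediate_value_Icc zero_le_one hcont.continuousOn ⟨?_, ?_⟩
    · simp [dilation_zero_left]
    · rw [hV.dilation_one]
      exact (not_le.1 hx1).le
  have hrpos : 0 < r := by
    refine lt_of_le_of_ne hr0 ?_
    rintro rfl
    simp [dilation_zero_left] at hr
  have hmem : dilation V step r x ∈ coord e ⁻¹' Metric.sphere 0 1 := by simpa using hr
  have hcr : c ≤ r := by
    have h1 := hcS _ hmem
    have h2 := hd.homogeneous r hrpos x 0
    rw [dilation_zero_right] at h2
    rw [h2] at h1
    exact h1.trans (mul_le_of_le_one_right hr0 hx)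
  refine ⟨(r⁻¹, dilation V step r x), ⟨⟨(one_le_inv₀ hrpos).2 hr1, inv_anti₀ hc0 hcr⟩, hmem⟩, ?_⟩
  simp only
  rw [hV.dilation_dilation, inv_mul_cancel₀ hrpos.ne', hV.dilation_one]

end Dilation

/-! ### Slices of translated balls. -/

section Slices

open MeasureTheory Set

variable {G : Type*} [LieRing G] [LieAlgebra ℝ G]
    [TopologicalSpace G] [IsTopologicalAddGroup G] [ContinuousSMul ℝ G] [T2Space G]
    {V : ℕ → Submodule ℝ G} [GradedLieAlgebra V] {step : ℕ} {d : G → G → ℝ}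

omit [IsTopologicalAddGroup G] [ContinuousSMul ℝ G] [T2Space G] in
theorem IsHomogeneousDistance.neg_mem_closedBall (hV : IsStratified V step)
    (hd : IsHomogeneousDistance V step d) {r : ℝ} {x : G} (hx : x ∈ closedBall d 0 r) :
    -x ∈ closedBall d 0 r := by
  have h1 := mul_smul_smul hV.one_le_step 1 (-1) x
  have h2 := mul_smul_smul hV.one_le_step 1 0 x
  have h3 := hd.left_invariant x (-x) 0
  simp only [one_smul, neg_smul, add_neg_cancel, zero_smul, add_zero] at h1 h2
  rw [h1, h2, hd.symm] at h3
  simp only [closedBall, mem_ofPred_eq] at hx ⊢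
  rwa [← h3]

/-- A left translate of the unit ball has no larger slice, by a vertical subspace, than the unit
ball itself. The subspace is the range of `L`. -/
theorem volume_preimage_closedBall_le [FiniteDimensional ℝ G] (hV : IsStratified V step)
    (hd : IsHomogeneousDistance V step d) (hconv : Convex ℝ (closedBall d 0 1)) {m : ℕ}
    {L : EuclideanSpace ℝ (Fin m) →ₗ[ℝ] G} (hL : Function.Injective L)
    (hLV : tail V 2 ≤ L.range) {z w : G} (hzw : z + w ∈ L.range) :
    volume (L ⁻¹' closedBall d z 1) ≤ volume (L ⁻¹' closedBall d 0 1) := by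
  obtain ⟨R, hR⟩ := LinearMap.exists_leftInverse_of_injective L (LinearMap.ker_eq_bot.2 hL)
  have hLc : Continuous L := L.continuous_of_finiteDimensional
  have hRc : Continuous R := R.continuous_of_finiteDimensional
  have hLR : ∀ y ∈ L.range, L (R y) = y := by
    rintro _ ⟨x, rfl⟩
    exact congrArg L (LinearMap.congr_fun hR x)
  set H : G → G := fun y => ∑ i ∈ Finset.Icc 2 step, bchTerm i z y with hH
  have hHc : Continuous H := continuous_finsetSum _ fun i _ => continuous_bchTerm i z
  have hHsub : ∀ k y y', y - y' ∈ tail V k → H y - H y' ∈ tail V (k + 1) := by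
    intro k y y' h
    simp only [hH, ← Finset.sum_sub_distrib]
    exact sum_mem fun i hi => bchTerm_sub_mem_tail hV (Finset.mem_Icc.1 hi).1 z h
  have hH0 : H 0 = 0 := Finset.sum_eq_zero fun i hi => by
    have := bchTerm_smul_smul (Finset.mem_Icc.1 hi).1 1 0 z
    rwa [one_smul, zero_smul] at this
  have hH2 : ∀ y, H y ∈ L.range := fun y => hLV (by
    have := hHsub 1 y 0 (by rw [hV.tail_one]; trivial)
    rwa [hH0, sub_zero] at this)
  -- This is `y ↦ z · (y + w)` in the coordinates `L`. The constant `z + w` cancels in increments,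
  -- and those of `H` gain a degree.
  have hmp : MeasurePreserving (fun x => x + R (z + w + H (L x + w))) volume volume := by
    refine measurePreserving_add_of_filtration (fun k => (tail V k).comap L)
      (fun i j hij => Submodule.comap_mono (tail_antitone V hij)) (s := step) ?_ ?_ ?_ ?_
    · simp only [hV.tail_one, Submodule.comap_top]
    · simp only [hV.tail_eq_bot, Submodule.comap_bot]
      exact LinearMap.ker_eq_bot.2 hL
    · exact (hRc.comp (continuous_const.add
        (hHc.comp (hLc.add continuous_const)))).measurable
    · intro k hk x y hxy
      have h1 := hHsub k (L x + w) (L y + w) (by simpa using hxy)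
      simp only [Submodule.mem_comap, ← map_sub, add_sub_add_left_eq_sub]
      rw [hLR _ (hLV (tail_antitone V (by omega) h1))]
      exact h1
  have hz : mul step z 0 = z := by
    have := mul_smul_smul hV.one_le_step 1 0 z
    simpa only [one_smul, zero_smul, add_zero] using this
  have hpre : (fun x => x + R (z + w + H (L x + w))) ⁻¹' (L ⁻¹' closedBall d z 1) =
      {x | L x + w ∈ closedBall d 0 1} := by
    ext x
    have h1 : L (x + R (z + w + H (L x + w))) = mul step z (L x + w) := by
      rw [map_add, hLR _ (add_mem hzw (hH2 _)), mul_eq_add hV.one_le_step]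
      abel
    have h2 := hd.left_invariant z (L x + w) 0
    rw [hz] at h2
    simp only [mem_preimage, h1, closedBall, mem_ofPred_eq, h2]
  have hball := fun z => hd.isClosed_closedBall z 1
  rw [← hmp.measure_preimage ((hball z).preimage hLc).measurableSet.nullMeasurableSet, hpre]
  exact volume_preimage_add_le hconv (fun _ => hd.neg_mem_closedBall hV) L w
    ((hball 0).preimage (hLc.add continuous_const)).measurableSet
    ((hball 0).preimage hLc).measurableSet

end Slices

/-! ### The vertical hyperplane and its area. -/

section VerticalSubgroup

open MeasureTheory Set

variable {G : Type*} [LieRing G] [LieAlgebra ℝ G] {V : ℕ → Submodule ℝ G} [GradedLieAlgebra V]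
  {step n : ℕ}

theorem IsStratified.exists_add_smul_mem_verticalSubgroup (hV : IsStratified V step)
    (e : Module.Basis (Fin n) ℝ G) {v : G} (hv : v ∈ V 1) (hv0 : v ≠ 0) (z : G) :
    ∃ s : ℝ, z + s • v ∈ verticalSubgroup V e v := by
  have hz : z ∈ V 1 ⊔ tail V 2 := by
    rw [layer_sup_tail, hV.tail_one]
    trivial
  obtain ⟨z₁, hz₁, z₂, hz₂, rfl⟩ := Submodule.mem_sup.1 hz
  set c := coord e
  have hcv : inner ℝ (c v) (c v) ≠ 0 := by simpa using hv0
  refine ⟨-(inner ℝ (c v) (c z₁) / inner ℝ (c v) (c v)), ?_⟩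
  rw [add_right_comm]
  refine Submodule.add_mem_sup ⟨add_mem hz₁ (Submodule.smul_mem _ _ hv), ?_⟩ hz₂
  simp only [SetLike.mem_coe, Submodule.mem_comap, LinearEquiv.coe_coe]
  rw [Submodule.mem_orthogonal_singleton_iff_inner_right, map_add, map_smul, inner_add_right,
    inner_smul_right]
  field_simp
  ring

theorem IsStratified.finrank_verticalSubgroup (hV : IsStratified V step)
    (e : Module.Basis (Fin n) ℝ G) {v : G} (hv : v ∈ V 1) (hv0 : v ≠ 0) :
    Module.finrank ℝ (verticalSubgroup V e v) = n - 1 := by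
  have : FiniteDimensional ℝ G := e.finiteDimensional_of_finite
  have hcompl : IsCompl (verticalSubgroup V e v) (ℝ ∙ v) := by
    constructor
    · rw [Submodule.disjoint_span_singleton' hv0]
      intro hmem
      obtain ⟨y, hy, t, ht, hyt⟩ := Submodule.mem_sup.1 hmem
      -- `t = v - y` lies both in `V₁` and in `V₂ ⊕ V₃ ⊕ ⋯`; hence `v = y` would be orthogonal to
      -- itself.
      have ht0 : t = 0 := by
        refine Submodule.disjoint_def.1 (disjoint_layer_tail (V := V) 1) t ?_ ht
        rw [← eq_sub_iff_add_eq'] at hyt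
        rw [hyt]
        exact sub_mem hv hy.1
      rw [ht0, add_zero] at hyt
      have hy2 := hy.2
      rw [hyt] at hy2
      simp only [SetLike.mem_coe, Submodule.mem_comap, LinearEquiv.coe_coe] at hy2
      rw [Submodule.mem_orthogonal_singleton_iff_inner_right] at hy2
      exact hv0 (by simpa using hy2)
    · rw [codisjoint_iff_le_sup]
      intro z _
      obtain ⟨s, hs⟩ := hV.exists_add_smul_mem_verticalSubgroup e hv hv0 z
      refine Submodule.mem_sup.2 ⟨_, hs, -(s • v),
        neg_mem (Submodule.smul_mem _ _ (Submodule.mem_span_singleton_self v)), by abel⟩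
  have h1 := Submodule.finrank_add_eq_of_isCompl hcompl
  rw [finrank_span_singleton hv0, Module.finrank_eq_card_basis e, Fintype.card_fin] at h1
  omega

/-- A linear parametrization of a subspace that carries the Lebesgue measure to the area. -/
theorem exists_linearMap_area_eq_volume (e : Module.Basis (Fin n) ℝ G) (N : Submodule ℝ G)
    (hN : Module.finrank ℝ N = n - 1) :
    ∃ L : EuclideanSpace ℝ (Fin (n - 1)) →ₗ[ℝ] G, Function.Injective L ∧ L.range = N ∧
      ∀ S : Set G, area e (S ∩ N) = volume (L ⁻¹' S) := by
  set c := coord e with hc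
  set M := N.map c.toLinearMap
  have hM : Module.finrank ℝ M = n - 1 := (LinearEquiv.finrank_map_eq c N).trans hN
  let b := (stdOrthonormalBasis ℝ M).reindex (finCongr hM)
  let f := M.subtypeₗᵢ.comp b.repr.symm.toLinearIsometry
  have hf : ∀ y, y ∈ M ↔ ∃ x, f x = y := by
    intro y
    constructor
    · intro hy
      exact ⟨b.repr ⟨y, hy⟩, by simp [f]⟩
    · rintro ⟨x, rfl⟩
      exact (b.repr.symm x).2
  have hfN : ∀ x, c.symm (f x) ∈ N := by
    intro x
    obtain ⟨y, hy, hyx⟩ := (hf (f x)).2 ⟨x, rfl⟩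
    rw [← hyx]
    simpa using hy
  refine ⟨c.symm.toLinearMap ∘ₗ f.toLinearMap, c.symm.injective.comp f.injective, ?_, fun S => ?_⟩
  · ext y
    constructor
    · rintro ⟨x, rfl⟩
      exact hfN x
    · intro hy
      obtain ⟨x, hx⟩ := (hf (c y)).1 ⟨y, hy, rfl⟩
      exact ⟨x, by simp [hx]⟩
  · have himg : c '' (S ∩ N) = f '' ((c.symm.toLinearMap ∘ₗ f.toLinearMap) ⁻¹' S) := by
      ext y
      constructor
      · rintro ⟨u, ⟨huS, huN⟩, rfl⟩
        obtain ⟨x, hx⟩ := (hf (c u)).1 ⟨u, huN, rfl⟩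
        exact ⟨x, by simpa [hx] using huS, hx⟩
      · rintro ⟨x, hx, rfl⟩
        exact ⟨c.symm (f x), ⟨hx, hfN x⟩, by simp⟩
    rw [area, ← hc, himg, f.isometry.euclideanHausdorffMeasure_image,
      EuclideanSpace.euclideanHausdorffMeasure_eq_volume]

end VerticalSubgroup

end StratifiedGroup

end

/-- Convex unit ball of a homogeneous distance: the maximum that defines `β(d, v)` exists, is finite,
and is the area of the central slice `N(v) ∩ B(0, 1)`. -/
theorem theorem5p2 {G : Type*} [LieRing G] [LieAlgebra ℝ G]
    [TopologicalSpace G] [IsTopologicalAddGroup G] [ContinuousSMul ℝ G] [T2Space G]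
    (V : ℕ → Submodule ℝ G) [GradedLieAlgebra V] (step : ℕ)
    (hV : StratifiedGroup.IsStratified V step)
    {n : ℕ} (e : Module.Basis (Fin n) ℝ G) (he : StratifiedGroup.IsGradedBasis V e)
    (d : G → G → ℝ) (hd : StratifiedGroup.IsHomogeneousDistance V step d)
    (hconv : Convex ℝ (StratifiedGroup.closedBall d 0 1))
    (v : G) (hv : v ∈ V 1) (hv0 : v ≠ 0) :
    IsGreatest
      {a : ENNReal | ∃ z ∈ StratifiedGroup.closedBall d 0 1,
        a = StratifiedGroup.area e
          (StratifiedGroup.closedBall d z 1 ∩ StratifiedGroup.verticalSubgroup V e v)}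
      (StratifiedGroup.beta V e d v) ∧
    StratifiedGroup.beta V e d v < ⊤ ∧
    StratifiedGroup.beta V e d v =
      StratifiedGroup.area e
        ((StratifiedGroup.verticalSubgroup V e v : Set G) ∩ StratifiedGroup.closedBall d 0 1) := by
  open StratifiedGroup in
  have : FiniteDimensional ℝ G := e.finiteDimensional_of_finite
  obtain ⟨L, hL, hLN, hLA⟩ := exists_linearMap_area_eq_volume e (verticalSubgroup V e v)
    (hV.finrank_verticalSubgroup e hv hv0)
  have hLV : tail V 2 ≤ L.range := hLN ▸ le_sup_right
  have hle : ∀ z, area e (closedBall d z 1 ∩ verticalSubgroup V e v) ≤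
      area e (closedBall d 0 1 ∩ verticalSubgroup V e v) := by
    intro z
    obtain ⟨s, hs⟩ := hV.exists_add_smul_mem_verticalSubgroup e hv hv0 z
    rw [hLA, hLA]
    exact volume_preimage_closedBall_le hV hd hconv hL hLV (hLN ▸ hs)
  have h0 : (0 : G) ∈ closedBall d 0 1 := (hd.dist_self 0).le.trans zero_le_one
  have hβ : beta V e d v = area e (closedBall d 0 1 ∩ verticalSubgroup V e v) :=
    le_antisymm (iSup₂_le fun z _ => hle z)
      (le_iSup₂_of_le (f := fun z (_ : z ∈ closedBall d 0 1) =>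
        area e (closedBall d z 1 ∩ verticalSubgroup V e v)) 0 h0 le_rfl)
  refine ⟨⟨⟨0, h0, hβ⟩, ?_⟩, ?_, by rw [hβ, Set.inter_comm]⟩
  · rintro _ ⟨z, -, rfl⟩
    rw [hβ]
    exact hle z
  · rw [hβ, hLA]
    have hemb : Topology.IsClosedEmbedding L :=
      LinearMap.isClosedEmbedding_of_injective (LinearMap.ker_eq_bot.2 hL)
    exact (hemb.isCompact_preimage (hd.isCompact_closedBall hV e)).measure_lt_top
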